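/- Let $M(x_1,x_2)=\max\{|x_1|,|x_2|\}$ and $B=[-\pi/2,\pi/2]^2$, and let $h:B\to\{y\in\mathbb{R}^3:|y|=1,\ y_3\ge 0\}$ be the map $$h(x_1,x_2)=\left(\frac{x_1\sin M(x_1,x_2)}{\sqrt{x_1^2+x_2^2}},\ \frac{x_2\sin M(x_1,x_2)}{\sqrt{x_1^2+x_2^2}},\ \cos M(x_1,x_2)\right),\qquad h(0,0)=(0,0,1).$$ Extend $h$ to a map $h:\mathbb{R}^2\to\{y\in\mathbb{R}^3:|y|=1\}$ by reflection: for every $k\in\mathbb{Z}$, the reflection of the plane in the line $x_1=\frac{\pi}{2}+k\pi$, and likewise the reflection in the line $x_2=\frac{\pi}{2}+k\pi$, corresponds under $h$ to the reflection $(y_1,y_2,y_3)\mapsto(y_1,y_2,-y_3)$. Let $\mathcal{Z}:\mathbb{R}^3\to\mathbb{R}^3\setminus\{0\}$ be the Zorich map $\mathcal{Z}(x_1,x_2,x_3)=e^{x_3}h(x_1,x_2)$. Then for almost every line $L$ in $\mathbb{R}^3$, the curve $(\mathcal{Z}\circ\mathcal{Z})(L)$ is dense in $\mathbb{R}^3$.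 Here "almost every" holds in both of the following senses: (i) with respect to the isometry-invariant measure on the space of affine lines in $\mathbb{R}^3$; (ii) for every point $P\in\mathbb{R}^3$, for almost every direction $u$ in the unit sphere with respect to surface measure, with $L=P+\mathbb{R}u$. -/

import Mathlib

noncomputable section

namespace Zorich

/-- Euclidean space `ℝ³`. Coordinates are `x 0`, `x 1`, `x 2`. -/
abbrev E3 : Type := EuclideanSpace ℝ (Fin 3)

/-! ### The Zorich map -/

/-- `M(x₁, x₂) = max (|x₁|, |x₂|)`. -/
def M (x₁ x₂ : ℝ) : ℝ := max |x₁| |x₂|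

/-- The map from the square `B = [-π/2, π/2]²` onto the closed upper unit hemisphere.
At the origin `x / 0 = 0` gives the value `(0, 0, 1)`, which is the continuous one. -/
def hSquare (x₁ x₂ : ℝ) : E3 :=
  !₂[x₁ * Real.sin (M x₁ x₂) / Real.sqrt (x₁ ^ 2 + x₂ ^ 2),
     x₂ * Real.sin (M x₁ x₂) / Real.sqrt (x₁ ^ 2 + x₂ ^ 2),
     Real.cos (M x₁ x₂)]

/-- Folding of the real line onto `[-π/2, π/2]` by the reflections in the points
`π/2 + k π`, `k ∈ ℤ` (a triangle wave). -/
def fold (x : ℝ) : ℝ := Real.arcsin (Real.sin x)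

/-- The extension of `hSquare` to the plane by reflection in the sides of the squares in the
domain and in the equator in the range. The sign of `cos x₁ * cos x₂` is `1` inside the squares
obtained from `B` by an even number of reflections and `-1` inside the others; on the sides of the
squares the third coordinate vanishes. The lemmas `h_eq_hSquare`, `h_reflect_left` and
`h_reflect_right` below characterize `h`. -/
def h (x₁ x₂ : ℝ) : E3 :=
  !₂[hSquare (fold x₁) (fold x₂) 0,
     hSquare (fold x₁) (fold x₂) 1,
     (SignType.sign (Real.cos x₁ * Real.cos x₂) : ℝ) * hSquare (fold x₁) (fold x₂) 2]

/-- The Zorich map `𝒵(x₁, x₂, x₃) = exp (x₃) h(x₁, x₂)`. -/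
def zorich (x : E3) : E3 := Real.exp (x 2) • h (x 0) (x 1)

/-- The reflection of `ℝ³` in the horizontal coordinate plane. -/
def reflectEquator (y : E3) : E3 := !₂[y 0, y 1, -y 2]

theorem fold_of_mem {x : ℝ} (hx : |x| ≤ Real.pi / 2) : fold x = x :=
  Real.arcsin_sin (abs_le.1 hx).1 (abs_le.1 hx).2

/-- `h` extends the map given on the square `B`. -/
theorem h_eq_hSquare {x₁ x₂ : ℝ} (h₁ : |x₁| ≤ Real.pi / 2) (h₂ : |x₂| ≤ Real.pi / 2) :
    h x₁ x₂ = hSquare x₁ x₂ := by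
  have key : (SignType.sign (Real.cos x₁ * Real.cos x₂) : ℝ) * Real.cos (M x₁ x₂)
      = Real.cos (M x₁ x₂) := by
    rcases (show M x₁ x₂ ≤ Real.pi / 2 from max_le h₁ h₂).eq_or_lt with hM | hM
    · rw [hM, Real.cos_pi_div_two, mul_zero]
    · have a₁ := abs_lt.1 ((le_max_left |x₁| |x₂|).trans_lt hM)
      have a₂ := abs_lt.1 ((le_max_right |x₁| |x₂|).trans_lt hM)
      rw [sign_pos (mul_pos (Real.cos_pos_of_mem_Ioo a₁) (Real.cos_pos_of_mem_Ioo a₂))]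
      simp
  ext i
  fin_cases i
  · simp [h, fold_of_mem h₁, fold_of_mem h₂]
  · simp [h, fold_of_mem h₁, fold_of_mem h₂]
  · simpa [h, fold_of_mem h₁, fold_of_mem h₂, hSquare] using key

theorem sin_reflect (k : ℤ) (x : ℝ) :
    Real.sin (2 * (Real.pi / 2 + k * Real.pi) - x) = Real.sin x := by
  rw [show 2 * (Real.pi / 2 + k * Real.pi) - x = (Real.pi - x) + k * (2 * Real.pi) by ring,
    Real.sin_add_int_mul_two_pi, Real.sin_pi_sub]

theorem cos_reflect (k : ℤ) (x : ℝ) :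
    Real.cos (2 * (Real.pi / 2 + k * Real.pi) - x) = -Real.cos x := by
  rw [show 2 * (Real.pi / 2 + k * Real.pi) - x = (Real.pi - x) + k * (2 * Real.pi) by ring,
    Real.cos_add_int_mul_two_pi, Real.cos_pi_sub]

/-- Reflection in a line `x₁ = π/2 + k π` corresponds to reflection in the equator. -/
theorem h_reflect_left (k : ℤ) (x₁ x₂ : ℝ) :
    h (2 * (Real.pi / 2 + k * Real.pi) - x₁) x₂ = reflectEquator (h x₁ x₂) := by
  ext i
  fin_cases i <;>
    simp [h, reflectEquator, fold, sin_reflect, cos_reflect, Left.sign_neg]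

/-- Reflection in a line `x₂ = π/2 + k π` corresponds to reflection in the equator. -/
theorem h_reflect_right (k : ℤ) (x₁ x₂ : ℝ) :
    h x₁ (2 * (Real.pi / 2 + k * Real.pi) - x₂) = reflectEquator (h x₁ x₂) := by
  ext i
  fin_cases i <;>
    simp [h, reflectEquator, fold, sin_reflect, cos_reflect, Left.sign_neg]

/-! ### The space of lines and its invariant measure -/

/-- The unit sphere of `ℝ³`. -/
abbrev S2 : Type := Metric.sphere (0 : E3) 1

/-- The surface measure on the unit sphere. -/
def surfaceMeasure : MeasureTheory.Measure S2 :=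
  (MeasureTheory.volume : MeasureTheory.Measure E3).toSphere

/-- The affine lines in `ℝ³`. -/
abbrev Line : Type := {L : AffineSubspace ℝ E3 // Module.finrank ℝ L.direction = 1}

/-- The line through the point `p` with direction `u`. -/
def lineThrough (p : E3) (u : S2) : Line :=
  ⟨AffineSubspace.mk' p (Submodule.span ℝ {(u : E3)}), by
    rw [AffineSubspace.direction_mk']
    exact finrank_span_singleton (ne_zero_of_mem_unit_sphere u)⟩

/-- The parametrization of lines by a direction and a point. -/
def lineMap (q : S2 × E3) : Line := lineThrough q.2 q.1

/-- A set of lines is measurable if the set of all pairs `(u, p)` that parametrize a line in it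
is a Borel set. -/
instance : MeasurableSpace Line := MeasurableSpace.map lineMap inferInstance

theorem measurable_lineMap : Measurable lineMap := fun _ hs => hs

/-- The isometry-invariant measure on the space of lines in `ℝ³`, that is (up to a constant factor)
`A ↦ ∫_{u ∈ S²} area {w ∈ u^⊥ | w + ℝ u ∈ A}`. Every line with direction `u` meets the slab
`{p | 0 ≤ ⟪u, p⟫ ≤ 1}` in a segment of length one, so by Fubini's theorem the volume of the set of
those points `p` of the slab whose line `p + ℝ u` is in `A` equals that area. -/
def lineMeasure : MeasureTheory.Measure Line :=
  ((surfaceMeasure.prod (MeasureTheory.volume : MeasureTheory.Measure E3)).restrict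
    {q | 0 ≤ inner ℝ (q.1 : E3) q.2 ∧ inner ℝ (q.1 : E3) q.2 ≤ 1}).map lineMap

end Zorich

end

noncomputable section

namespace Zorich

open Filter Topology Metric Set MeasureTheory

/-! ### Coordinates -/

/-! Fix a nonempty open `U` and let `W` be the interior of its preimage under `zorich ∘ zorich`. The
heart of the proof is that, for each `P`, the set of vectors `v` whose line `P + ℝ v` misses `W` is
Lebesgue null (`volume_missing`).

Choose `T` with `zorich T ∈ U`. By periodicity the second Zorich map sends neighbourhoods of all the
points `T + latticeVec m n` into `U`. Modulo periods, let `x` satisfy `x 0 = π/2`, with `x 1` near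
`0` and `x 2` large. Then `zorich x` lies in the plane `y 2 = 0`, hence at bounded distance from
such a translate. There the first map expands by a factor comparable to `exp (x 2)`, so within `C *
exp (-x 2)` of `x` there is a ball of radius `c * exp (-x 2)` inside `W`
(`exists_ball_subset_zorich_zorich_preimage`).

If `v 1 / v 0` is irrational and `v 2 ≠ 0`, the line passes through such points `x` infinitely
often, with `x 2 → ∞`. Dividing by the time parameter turns the balls into holes of the missing set
near `v`, at arbitrarily small scales (`missing_porous`), so the Lebesgue density theorem applies
(`measure_eq_zero_of_porous`). A countable basis, polar coordinates and Fubini's theorem give both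
forms of "almost every". -/

theorem abs_coord_le_norm (x : E3) (i : Fin 3) : |x i| ≤ ‖x‖ := by
  simpa using PiLp.norm_apply_le x i

theorem norm_le_sum_abs (x : E3) : ‖x‖ ≤ |x 0| + |x 1| + |x 2| := by
  rw [EuclideanSpace.norm_eq, Fin.sum_univ_three]
  refine Real.sqrt_le_iff.2 ⟨by positivity, ?_⟩
  simp only [Real.norm_eq_abs]
  nlinarith [abs_nonneg (x 0), abs_nonneg (x 1), abs_nonneg (x 2),
    mul_nonneg (abs_nonneg (x 0)) (abs_nonneg (x 1)),
    mul_nonneg (abs_nonneg (x 0)) (abs_nonneg (x 2)),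
    mul_nonneg (abs_nonneg (x 1)) (abs_nonneg (x 2))]

theorem norm_sq_eq (x : E3) : ‖x‖ ^ 2 = x 0 ^ 2 + x 1 ^ 2 + x 2 ^ 2 := by
  rw [EuclideanSpace.norm_eq, Real.sq_sqrt (by positivity), Fin.sum_univ_three]
  simp

/-- The lattice vector `2π (m, n, 0)`. -/
def latticeVec (m n : ℤ) : E3 := !₂[m * (2 * Real.pi), n * (2 * Real.pi), 0]

/-- The vertical vector `(0, 0, t)`. -/
def vertical (t : ℝ) : E3 := !₂[0, 0, t]

/-! ### Symmetries of the Zorich map -/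

theorem zorich_add_latticeVec (x : E3) (m n : ℤ) : zorich (x + latticeVec m n) = zorich x := by
  simp [zorich, latticeVec, h, fold, Real.sin_add_int_mul_two_pi, Real.cos_add_int_mul_two_pi]

theorem zorich_add_vertical (x : E3) (t : ℝ) :
    zorich (x + vertical t) = Real.exp t • zorich x := by
  simp [zorich, vertical, Real.exp_add, smul_smul, mul_comm]

/-- The reflection of `ℝ³` in the plane `x₁ = π / 2`. -/
def reflectSide (x : E3) : E3 := !₂[Real.pi - x 0, x 1, x 2]

theorem reflectSide_involutive : Function.Involutive reflectSide := fun x => by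
  ext i
  fin_cases i <;> simp [reflectSide]

theorem reflectEquator_involutive : Function.Involutive reflectEquator := fun x => by
  ext i
  fin_cases i <;> simp [reflectEquator]

theorem dist_reflectSide (x y : E3) : dist (reflectSide x) (reflectSide y) = dist x y := by
  rw [EuclideanSpace.dist_eq, EuclideanSpace.dist_eq]
  simp [Fin.sum_univ_three, reflectSide, Real.dist_eq, sub_sq_comm (y 0)]

theorem dist_reflectEquator (x y : E3) :
    dist (reflectEquator x) (reflectEquator y) = dist x y := by
  rw [EuclideanSpace.dist_eq, EuclideanSpace.dist_eq]
  simp only [Fin.sum_univ_three, reflectEquator, Real.dist_eq]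
  simp [neg_add_eq_sub, abs_sub_comm]

theorem zorich_reflectSide (x : E3) : zorich (reflectSide x) = reflectEquator (zorich x) := by
  have := h_reflect_left 0 (x 0) (x 1)
  rw [show 2 * (Real.pi / 2 + ((0 : ℤ) : ℝ) * Real.pi) - x 0 = Real.pi - x 0 by
    push_cast; ring] at this
  simp only [zorich]
  ext i
  fin_cases i <;> simp [reflectSide, reflectEquator, this]

/-! ### A smooth chart of the Zorich map near a side of the square -/

/-- The smooth formula for the Zorich map on the part `|x₂| ≤ x₁ ≤ π / 2` of the square. -/
def faceMap (x : E3) : E3 :=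
  Real.exp (x 2) • !₂[x 0 * Real.sin (x 0) / Real.sqrt (x 0 ^ 2 + x 1 ^ 2),
     x 1 * Real.sin (x 0) / Real.sqrt (x 0 ^ 2 + x 1 ^ 2), Real.cos (x 0)]

/-- The inverse of `faceMap`. -/
def faceInv (y : E3) : E3 :=
  !₂[Real.arccos (y 2 / ‖y‖), Real.arccos (y 2 / ‖y‖) * (y 1 / y 0), Real.log ‖y‖]

theorem zorich_eq_faceMap {x : E3} (h₁ : |x 1| ≤ x 0) (h₀ : x 0 ≤ Real.pi / 2) :
    zorich x = faceMap x := by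
  have h0 : |x 0| = x 0 := abs_of_nonneg ((abs_nonneg _).trans h₁)
  have hM : M (x 0) (x 1) = x 0 := by rw [M, h0, max_eq_left h₁]
  rw [zorich, h_eq_hSquare (h0.trans_le h₀) (h₁.trans h₀), hSquare, hM, faceMap]

theorem sin_arccos_div_norm {y : E3} (hy : y ≠ 0) :
    Real.sin (Real.arccos (y 2 / ‖y‖)) = Real.sqrt (y 0 ^ 2 + y 1 ^ 2) / ‖y‖ := by
  have hr : 0 < ‖y‖ := norm_pos_iff.2 hy
  have : 1 - (y 2 / ‖y‖) ^ 2 = (y 0 ^ 2 + y 1 ^ 2) / ‖y‖ ^ 2 := by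
    have := norm_sq_eq y
    field_simp
    linarith
  rw [Real.sin_arccos, this, Real.sqrt_div' _ (by positivity), Real.sqrt_sq hr.le]

theorem cos_arccos_div_norm (y : E3) :
    Real.cos (Real.arccos (y 2 / ‖y‖)) = y 2 / ‖y‖ := by
  have := abs_le.1 (abs_coord_le_norm y 2)
  rcases (norm_nonneg y).eq_or_lt with h | hr
  · simp [← h]
  · exact Real.cos_arccos (by rw [le_div_iff₀ hr]; linarith) (by rw [div_le_one hr]; exact this.2)

theorem abs_coord_div_norm_lt_one {y : E3} (hy : 0 < y 0) : |y 2 / ‖y‖| < 1 := by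
  have hr : 0 < ‖y‖ := norm_pos_iff.2 fun h0 => by simp [h0] at hy
  rw [abs_div, abs_norm, div_lt_one hr]
  refine lt_of_pow_lt_pow_left₀ 2 hr.le ?_
  rw [norm_sq_eq, sq_abs]
  nlinarith [pow_pos hy 2, sq_nonneg (y 1)]

/-- No sign condition on `y 2` is needed: unlike `zorich`, which folds at `x 0 = π/2`, the chart
continues smoothly across that plane. -/
theorem faceMap_faceInv {y : E3} (hy : 0 < y 0) : faceMap (faceInv y) = y := by
  have hy0 : y ≠ 0 := fun h0 => by simp [h0] at hy
  have hr : 0 < ‖y‖ := norm_pos_iff.2 hy0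
  have hρ : 0 < Real.sqrt (y 0 ^ 2 + y 1 ^ 2) := Real.sqrt_pos.2 (by positivity)
  have hθ : 0 < Real.arccos (y 2 / ‖y‖) :=
    Real.arccos_pos.2 (abs_lt.1 (abs_coord_div_norm_lt_one hy)).2
  have hsqrt : Real.sqrt (Real.arccos (y 2 / ‖y‖) ^ 2
      + (Real.arccos (y 2 / ‖y‖) * (y 1 / y 0)) ^ 2)
      = Real.arccos (y 2 / ‖y‖) * Real.sqrt (y 0 ^ 2 + y 1 ^ 2) / y 0 := by
    rw [Real.sqrt_eq_iff_mul_self_eq_of_pos (by positivity)]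
    have := Real.mul_self_sqrt (show 0 ≤ y 0 ^ 2 + y 1 ^ 2 by positivity)
    field_simp
    nlinarith
  ext i
  fin_cases i
  all_goals
    simp only [faceMap, faceInv, Fin.zero_eta, Fin.mk_one, Fin.reduceFinMk, PiLp.smul_apply,
      smul_eq_mul, PiLp.toLp_apply, Matrix.cons_val, Matrix.cons_val_zero, Matrix.cons_val_one,
      hsqrt, Real.exp_log hr, sin_arccos_div_norm hy0, cos_arccos_div_norm]
    field_simp

theorem contDiffAt_faceMap {x : E3} (hx : 0 < x 0) : ContDiffAt ℝ 1 faceMap x := by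
  have : x 0 ^ 2 + x 1 ^ 2 ≠ 0 := by positivity
  have : √(x 0 ^ 2 + x 1 ^ 2) ≠ 0 := by positivity
  rw [contDiffAt_euclidean]
  intro i
  fin_cases i <;> simp [faceMap] <;> fun_prop (disch := assumption)

theorem contDiffAt_faceInv {y : E3} (hy : 0 < y 0) : ContDiffAt ℝ 1 faceInv y := by
  have hy0 : y ≠ 0 := fun h0 => by simp [h0] at hy
  have hr : ‖y‖ ≠ 0 := norm_ne_zero_iff.2 hy0
  have hlt := abs_lt.1 (abs_coord_div_norm_lt_one hy)
  have hnorm : ContDiffAt ℝ 1 (fun y : E3 => ‖y‖) y := contDiffAt_norm ℝ hy0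
  have hdiv : ContDiffAt ℝ 1 (fun y : E3 => y 2 / ‖y‖) y :=
    ContDiffAt.div (by fun_prop) hnorm hr
  have harc : ContDiffAt ℝ 1 (fun y : E3 => Real.arccos (y 2 / ‖y‖)) y :=
    ContDiffAt.comp (g := Real.arccos) y (Real.contDiffAt_arccos hlt.1.ne' hlt.2.ne) hdiv
  rw [contDiffAt_euclidean]
  intro i
  fin_cases i
  · simpa [faceInv] using harc
  · simpa [faceInv] using harc.mul (ContDiffAt.div (by fun_prop) (by fun_prop) hy.ne')
  · simpa [faceInv] using hnorm.log hr

/-- On the plane `x₁ = π / 2` the map `faceInv` inverts `faceMap`. -/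
theorem faceInv_faceMap_side (t : ℝ) :
    faceInv (faceMap !₂[Real.pi / 2, t, 0]) = !₂[Real.pi / 2, t, 0] := by
  have hρ : 0 < Real.sqrt ((Real.pi / 2) ^ 2 + t ^ 2) := Real.sqrt_pos.2 (by positivity)
  have hn : ‖faceMap !₂[Real.pi / 2, t, 0]‖ = 1 := by
    rw [← sq_eq_sq₀ (norm_nonneg _) zero_le_one, norm_sq_eq]
    have := Real.sq_sqrt (show 0 ≤ (Real.pi / 2) ^ 2 + t ^ 2 by positivity)
    simp [faceMap, div_pow, -Real.sqrt_pos] at this ⊢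
    rw [this]
    field_simp
  have := Real.pi_pos.ne'
  ext i
  fin_cases i
  all_goals
    simp only [faceInv, hn]
    simp [faceMap]
  field_simp

/-! ### Balls mapped near lattice translates of a point -/

theorem exists_latticeVec_near (T z : E3) :
    ∃ m n : ℤ, ‖T + latticeVec m n - z‖ ≤ 2 * Real.pi + |T 2 - z 2| := by
  have key : ∀ s : ℝ, |s + -round (s / (2 * Real.pi)) * (2 * Real.pi)| ≤ Real.pi := by
    intro s
    have h1 := abs_sub_round (s / (2 * Real.pi))
    have hpi := Real.pi_pos
    rw [show s + -round (s / (2 * Real.pi)) * (2 * Real.pi)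
      = (s / (2 * Real.pi) - round (s / (2 * Real.pi))) * (2 * Real.pi) by field_simp; ring,
      abs_mul, abs_of_pos (by positivity : 0 < 2 * Real.pi)]
    nlinarith
  refine ⟨-round ((T 0 - z 0) / (2 * Real.pi)), -round ((T 1 - z 1) / (2 * Real.pi)),
    (norm_le_sum_abs _).trans ?_⟩
  have h0 := key (T 0 - z 0)
  have h1 := key (T 1 - z 1)
  rw [sub_add_eq_add_sub] at h0 h1
  simp only [latticeVec, PiLp.sub_apply, PiLp.add_apply, Matrix.cons_val, Matrix.cons_val_zero,
    Matrix.cons_val_one, Int.cast_neg, add_zero]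
  linarith

/-- Near points of the line `x₁ = π / 2`, `x₂ = 0` that are far up, the Zorich map sends balls of
radius comparable to `exp (-x₃)` into balls around the translates of a given point. -/
theorem exists_ball_zorich_near_lattice {T : E3} {ε : ℝ} (hε : 0 < ε) (hT : ε < T 2) :
    ∃ C > 0, ∃ c > 0, ∃ δ > 0, ∃ S : ℝ, ∀ x : E3, x 0 = Real.pi / 2 → |x 1| < δ → S < x 2 →
      ∃ x' ∈ closedBall x (C * Real.exp (-x 2)), ∀ z ∈ ball x' (c * Real.exp (-x 2)),
        ∃ m n : ℤ, zorich z ∈ ball (T + latticeVec m n) ε := by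
  set b : ℝ → E3 := fun t => !₂[Real.pi / 2, t, 0] with hb
  have hb0 : 0 < b 0 0 := by simp [hb]; positivity
  have hinv : ∀ t, faceInv (faceMap (b t)) = b t := faceInv_faceMap_side
  have hy0 : 0 < faceMap (b 0) 0 := by
    simp only [faceMap, hb]
    simp
    positivity
  obtain ⟨Kg, sg, hsg, hg⟩ := (contDiffAt_faceInv hy0).exists_lipschitzOnWith
  obtain ⟨Kf, sf, hsf, hf⟩ := (contDiffAt_faceMap hb0).exists_lipschitzOnWith
  have hcoord : ∀ᶠ z in 𝓝 (b 0), 1 < z 0 ∧ z 0 < 2 ∧ |z 1| < 1 := by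
    have h0 : ContinuousAt (fun z : E3 => z 0) (b 0) := by fun_prop
    have h1 : ContinuousAt (fun z : E3 => |z 1|) (b 0) := by fun_prop
    have p3 := Real.pi_gt_three
    have p4 := Real.pi_lt_four
    filter_upwards [h0.eventually (lt_mem_nhds (show (1 : ℝ) < b 0 0 by simp [hb]; linarith)),
      h0.eventually (gt_mem_nhds (show b 0 0 < (2 : ℝ) by simp [hb]; linarith)),
      h1.eventually (gt_mem_nhds (show |b 0 1| < (1 : ℝ) by simp [hb]))] with z h1 h2 h3
    exact ⟨h1, h2, h3⟩
  obtain ⟨ρ₂, hρ₂, hball₂⟩ := Metric.mem_nhds_iff.1 (inter_mem hsf hcoord)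
  have hgc : ContinuousAt faceInv (faceMap (b 0)) := (contDiffAt_faceInv hy0).continuousAt
  have hgn : ∀ᶠ y in 𝓝 (faceMap (b 0)), faceInv y ∈ ball (b 0) (ρ₂ / 2) :=
    hgc (by rw [hinv]; exact ball_mem_nhds _ (by positivity))
  have hpos : ∀ᶠ y in 𝓝 (faceMap (b 0)), 0 < y 0 := by
    have h0 : ContinuousAt (fun z : E3 => z 0) (faceMap (b 0)) := by fun_prop
    exact h0.eventually (lt_mem_nhds hy0)
  obtain ⟨ρ₁, hρ₁, hball₁⟩ := Metric.mem_nhds_iff.1 (inter_mem hsg (inter_mem hgn hpos))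
  have hbc : ContinuousAt (fun t => faceMap (b t)) 0 := by
    refine (contDiffAt_faceMap hb0).continuousAt.comp ?_
    simp only [hb]
    fun_prop
  obtain ⟨δ, hδ, hδb⟩ := Metric.continuousAt_iff.1 hbc (ρ₁ / 2) (by positivity)
  -- `D` bounds the distance from a point of the plane `y 2 = 0` to the nearest lattice translate of
  -- `T`; it does not depend on `x`.
  set D : ℝ := 2 * Real.pi + T 2 with hD
  have hD0 : 0 < D := by have := Real.pi_pos; linarith
  -- Chosen so that `Kf * c < ε`, also when `Kf = 0`.
  set c : ℝ := ε / (Kf + 1) with hc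
  have hc0 : 0 < c := by positivity
  have hexp : ∀ K : ℝ, Tendsto (fun s => K * Real.exp (-s)) atTop (𝓝 0) := fun K => by
    simpa using Real.tendsto_exp_neg_atTop_nhds_zero.const_mul K
  obtain ⟨S, hS⟩ := eventually_atTop.1 (((hexp D).eventually
    (gt_mem_nhds (show 0 < ρ₁ / 2 by positivity))).and ((hexp c).eventually
    (gt_mem_nhds (show 0 < ρ₂ / 2 by positivity))))
  refine ⟨Kg * D + 1, by positivity, c, hc0, δ, hδ, S, fun x hx0 hx1 hx2 => ?_⟩
  obtain ⟨hS₁, hS₂⟩ := hS _ hx2.le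
  have hRE : Real.exp (x 2) * Real.exp (-x 2) = 1 := by rw [← Real.exp_add]; simp
  have hR0 := Real.exp_pos (x 2)
  have hE0 := Real.exp_pos (-x 2)
  have hxb : x = b (x 1) + vertical (x 2) := by
    ext i
    fin_cases i <;> simp [hb, vertical, hx0]
  set R := Real.exp (x 2)
  set E := Real.exp (-x 2)
  set u := faceMap (b (x 1)) with hu
  have hu2 : u 2 = 0 := by simp [hu, faceMap, hb]
  have hu1 : dist u (faceMap (b 0)) < ρ₁ / 2 := hδb (by simpa using hx1)
  obtain ⟨m, n, hmn⟩ := exists_latticeVec_near T (R • u)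
  set y := T + latticeVec m n with hy
  have hy2 : y 2 = T 2 := by simp [hy, latticeVec]
  have hTpos : 0 < T 2 := hε.trans hT
  have hyu : ‖y - R • u‖ ≤ D := by
    simpa [hu2, abs_of_pos hTpos] using hmn
  have hdist : dist (E • y) u ≤ D * E := by
    rw [dist_eq_norm, show E • y - u = E • (y - R • u) by
      rw [smul_sub, smul_smul, mul_comm E R, hRE, one_smul], norm_smul, Real.norm_of_nonneg hE0.le]
    nlinarith
  have hy_mem := @hball₁ (E • y) (by
    rw [mem_ball]; linarith [dist_triangle (E • y) u (faceMap (b 0))])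
  have hu_mem := @hball₁ u (by rw [mem_ball]; linarith)
  set p := faceInv (E • y) with hp
  have hFx : faceMap p = E • y := faceMap_faceInv hy_mem.2.2
  have hxd : dist p (b (x 1)) ≤ Kg * D * E := by
    rw [← hinv (x 1)]
    refine (hg.dist_le_mul _ hy_mem.1 _ hu_mem.1).trans ?_
    rw [mul_assoc]
    gcongr
  refine ⟨p + vertical (x 2), ?_, fun z hz => ⟨m, n, ?_⟩⟩
  · rw [mem_closedBall]
    calc dist (p + vertical (x 2)) x
        = dist (p + vertical (x 2)) (b (x 1) + vertical (x 2)) := by rw [← hxb]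
      _ ≤ Kg * D * E := by rwa [dist_add_right]
      _ ≤ (Kg * D + 1) * E := by gcongr; linarith
  · set w := z - vertical (x 2) with hw
    have hzw : z = w + vertical (x 2) := by simp [hw]
    have hwx : dist w p < c * E := by
      rw [mem_ball] at hz
      rwa [hzw, dist_add_right] at hz
    have hpm : dist p (b 0) < ρ₂ / 2 := hy_mem.2.1
    have hx_mem := @hball₂ p (by rw [mem_ball]; linarith)
    have hw_mem := @hball₂ w (by rw [mem_ball]; linarith [dist_triangle w p (b 0)])
    have hFw : dist (R • faceMap w) y < ε := by
      have h1 := hf.dist_le_mul _ hw_mem.1 _ hx_mem.1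
      rw [hFx] at h1
      have h2 : y = R • E • y := by rw [smul_smul, hRE, one_smul]
      conv_lhs => rw [h2]
      rw [dist_smul₀, Real.norm_of_nonneg hR0.le]
      calc R * dist (faceMap w) (E • y) ≤ R * (Kf * (c * E)) := by gcongr; exact h1.trans (by gcongr)
        _ = Kf * c * (R * E) := by ring
        _ < ε := by
          rw [hRE, hc, mul_one, mul_div_assoc', div_lt_iff₀ (by positivity)]
          nlinarith
    -- Lattice translations preserve height and `ε < T 2`, so the image stays above the equatorial
    -- plane. This forces `w 0 ≤ π/2`, the side on which the chart agrees with `zorich`.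
    have hcos : 0 < Real.cos (w 0) := by
      have h1 := (abs_coord_le_norm (R • faceMap w - y) 2).trans_lt (by rwa [← dist_eq_norm])
      rw [PiLp.sub_apply, hy2] at h1
      have h2 : 0 < (R • faceMap w) 2 := by linarith [(abs_lt.1 h1).1]
      simp only [faceMap] at h2
      simp at h2
      have := pos_of_mul_pos_right h2 hR0.le
      exact pos_of_mul_pos_right this (Real.exp_pos _).le
    obtain ⟨h1, h2, h3⟩ := hw_mem.2
    have hle : w 0 ≤ Real.pi / 2 := by
      by_contra! hlt
      have := Real.pi_gt_three
      linarith [Real.cos_nonpos_of_pi_div_two_le_of_le hlt.le (by linarith)]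
    rw [hzw, zorich_add_vertical, zorich_eq_faceMap (by linarith) hle]
    exact hFw

theorem reflectEquator_add_latticeVec (T : E3) (m n : ℤ) :
    reflectEquator (T + latticeVec m n) = reflectEquator T + latticeVec m n := by
  ext i
  fin_cases i <;> simp [reflectEquator, latticeVec]

theorem continuous_reflectSide : Continuous reflectSide :=
  (Isometry.of_dist_eq dist_reflectSide).continuous

theorem continuous_reflectEquator : Continuous reflectEquator :=
  (Isometry.of_dist_eq dist_reflectEquator).continuous

/-- The case `T 2 < 0` reduces to `T 2 > 0` by conjugating with `reflectSide`, which fixes the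
points `x` in question, and `reflectEquator`. -/
theorem exists_ball_zorich_near_lattice_of_ne_zero {T : E3} {ε : ℝ} (hε : 0 < ε) (hT : T 2 ≠ 0) :
    ∃ C > 0, ∃ c > 0, ∃ δ > 0, ∃ S : ℝ, ∀ x : E3, x 0 = Real.pi / 2 → |x 1| < δ → S < x 2 →
      ∃ x' ∈ closedBall x (C * Real.exp (-x 2)), ∀ z ∈ ball x' (c * Real.exp (-x 2)),
        ∃ m n : ℤ, zorich z ∈ ball (T + latticeVec m n) ε := by
  have key : ∀ T : E3, 0 < T 2 →
      ∃ C > 0, ∃ c > 0, ∃ δ > 0, ∃ S : ℝ, ∀ x : E3, x 0 = Real.pi / 2 → |x 1| < δ → S < x 2 →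
        ∃ x' ∈ closedBall x (C * Real.exp (-x 2)), ∀ z ∈ ball x' (c * Real.exp (-x 2)),
          ∃ m n : ℤ, zorich z ∈ ball (T + latticeVec m n) ε := by
    intro T hT
    obtain ⟨C, hC, c, hc, δ, hδ, S, H⟩ := exists_ball_zorich_near_lattice (T := T)
      (ε := min ε (T 2 / 2)) (by positivity) ((min_le_right _ _).trans_lt (by linarith))
    refine ⟨C, hC, c, hc, δ, hδ, S, fun x hx0 hx1 hx2 => ?_⟩
    obtain ⟨x', hx', hz⟩ := H x hx0 hx1 hx2
    refine ⟨x', hx', fun z hz' => ?_⟩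
    obtain ⟨m, n, hmn⟩ := hz z hz'
    exact ⟨m, n, ball_subset_ball (min_le_left _ _) hmn⟩
  rcases hT.lt_or_gt with hT | hT
  · obtain ⟨C, hC, c, hc, δ, hδ, S, H⟩ := key (reflectEquator T) (by simpa [reflectEquator])
    refine ⟨C, hC, c, hc, δ, hδ, S, fun x hx0 hx1 hx2 => ?_⟩
    obtain ⟨x', hx', hz⟩ := H x hx0 hx1 hx2
    have hx : reflectSide x = x := by
      ext i
      fin_cases i <;> simp [reflectSide, hx0]
      ring
    refine ⟨reflectSide x', ?_, fun z hz' => ?_⟩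
    · rw [mem_closedBall, ← hx, dist_reflectSide, hx]
      exact hx'
    · rw [mem_ball, ← reflectSide_involutive z, dist_reflectSide] at hz'
      obtain ⟨m, n, hmn⟩ := hz _ hz'
      refine ⟨m, n, ?_⟩
      rwa [zorich_reflectSide, ← reflectEquator_add_latticeVec, mem_ball,
        dist_reflectEquator] at hmn
  · exact key T hT

/-! ### Preimages of generic points, with continuity there -/

theorem continuousAt_zorich {x : E3} (h₀ : |x 0| < Real.pi / 2) (h₁ : |x 1| < Real.pi / 2)
    (hx : x 0 ≠ 0) : ContinuousAt zorich x := by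
  have c0 : ContinuousAt (fun z : E3 => |z 0|) x := by fun_prop
  have c1 : ContinuousAt (fun z : E3 => |z 1|) x := by fun_prop
  have heq : (fun z : E3 => Real.exp (z 2) • hSquare (z 0) (z 1)) =ᶠ[𝓝 x] zorich := by
    filter_upwards [c0.eventually (gt_mem_nhds h₀), c1.eventually (gt_mem_nhds h₁)] with z h h'
    rw [zorich, h_eq_hSquare h.le h'.le]
  refine ContinuousAt.congr ?_ heq
  have hρ : √(x 0 ^ 2 + x 1 ^ 2) ≠ 0 := by positivity
  unfold hSquare M
  fun_prop (disch := assumption)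

theorem exists_zorich_eq_of_pos {y : E3} (hy0 : y 0 ≠ 0) (hy2 : 0 < y 2) (hy : ‖y‖ ≠ 1) :
    ∃ x : E3, x 2 ≠ 0 ∧ zorich x = y ∧ ContinuousAt zorich x := by
  have hyne : y ≠ 0 := fun h0 => by simp [h0] at hy0
  have hr : 0 < ‖y‖ := norm_pos_iff.2 hyne
  have hρ : 0 < Real.sqrt (y 0 ^ 2 + y 1 ^ 2) := Real.sqrt_pos.2 (by positivity)
  have hlt : y 2 / ‖y‖ < 1 := by
    rw [div_lt_one hr]
    refine lt_of_pow_lt_pow_left₀ 2 hr.le ?_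
    rw [norm_sq_eq]
    nlinarith [sq_pos_of_ne_zero hy0, sq_nonneg (y 1)]
  set θ := Real.arccos (y 2 / ‖y‖)
  have hθ0 : 0 < θ := Real.arccos_pos.2 hlt
  have hθ1 : θ < Real.pi / 2 := Real.arccos_lt_pi_div_two.2 (by positivity)
  have hsin : Real.sin θ = Real.sqrt (y 0 ^ 2 + y 1 ^ 2) / ‖y‖ := sin_arccos_div_norm hyne
  have hcos : Real.cos θ = y 2 / ‖y‖ := cos_arccos_div_norm y
  set m := max |y 0| |y 1| with hm
  have hm0 : 0 < m := lt_max_of_lt_left (abs_pos.2 hy0)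
  have ha0 : |θ / m * y 0| ≤ θ := by
    rw [abs_mul, abs_of_pos (by positivity), div_mul_eq_mul_div, div_le_iff₀ hm0]
    gcongr
    exact le_max_left _ _
  have ha1 : |θ / m * y 1| ≤ θ := by
    rw [abs_mul, abs_of_pos (by positivity), div_mul_eq_mul_div, div_le_iff₀ hm0]
    gcongr
    exact le_max_right _ _
  have hM : M (θ / m * y 0) (θ / m * y 1) = θ := by
    rw [M, abs_mul, abs_mul, abs_of_pos (by positivity : 0 < θ / m),
      ← mul_max_of_nonneg _ _ (by positivity), ← hm]
    field_simp
  have hsqrt : Real.sqrt ((θ / m * y 0) ^ 2 + (θ / m * y 1) ^ 2)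
      = θ / m * Real.sqrt (y 0 ^ 2 + y 1 ^ 2) := by
    rw [mul_pow, mul_pow, ← mul_add, Real.sqrt_mul (by positivity), Real.sqrt_sq (by positivity)]
  -- The horizontal part is the multiple of `(y 0, y 1)` whose maximum norm is the polar angle `θ`
  -- of `y`.
  refine ⟨!₂[θ / m * y 0, θ / m * y 1, Real.log ‖y‖], ?_, ?_, ?_⟩
  · simp only [Matrix.cons_val]
    exact Real.log_ne_zero_of_pos_of_ne_one hr hy
  · rw [zorich]
    simp only [Matrix.cons_val, Matrix.cons_val_zero, Matrix.cons_val_one]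
    rw [h_eq_hSquare (ha0.trans hθ1.le) (ha1.trans hθ1.le), hSquare, hM, hsqrt,
      hsin, hcos, Real.exp_log hr]
    ext i
    fin_cases i <;> simp <;> field_simp
  · exact continuousAt_zorich (ha0.trans_lt hθ1) (ha1.trans_lt hθ1)
      (mul_ne_zero (by positivity) hy0)

theorem exists_zorich_eq {y : E3} (hy0 : y 0 ≠ 0) (hy2 : y 2 ≠ 0) (hy : ‖y‖ ≠ 1) :
    ∃ x : E3, x 2 ≠ 0 ∧ zorich x = y ∧ ContinuousAt zorich x := by
  rcases hy2.lt_or_gt with hy2 | hy2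
  · have hn : ‖reflectEquator y‖ = ‖y‖ := by
      rw [← sq_eq_sq₀ (norm_nonneg _) (norm_nonneg _), norm_sq_eq, norm_sq_eq]
      simp [reflectEquator]
    obtain ⟨x, h2, hx, hc⟩ := exists_zorich_eq_of_pos (y := reflectEquator y)
      (by simpa [reflectEquator]) (by simpa [reflectEquator]) (by rwa [hn])
    refine ⟨reflectSide x, by simpa [reflectSide], ?_, ?_⟩
    · rw [zorich_reflectSide, hx, reflectEquator_involutive]
    · have heq : zorich = reflectEquator ∘ zorich ∘ reflectSide := by
        funext z
        simp [zorich_reflectSide, reflectEquator_involutive _]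
      rw [heq]
      refine continuous_reflectEquator.continuousAt.comp
        (ContinuousAt.comp ?_ continuous_reflectSide.continuousAt)
      rwa [reflectSide_involutive]
  · exact exists_zorich_eq_of_pos hy0 hy2 hy

theorem volume_setOf_linear_eq_zero {f : E3 →ₗ[ℝ] ℝ} (hf : f ≠ 0) :
    volume {x : E3 | f x = 0} = 0 :=
  Measure.addHaar_submodule volume (LinearMap.ker f) (by rwa [Ne, LinearMap.ker_eq_top])

theorem volume_setOf_coord_eq_mul_coord {i j : Fin 3} (hij : i ≠ j) (q : ℝ) :
    volume {x : E3 | x i = q * x j} = 0 := by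
  have := volume_setOf_linear_eq_zero
    (f := (EuclideanSpace.projₗ i : E3 →ₗ[ℝ] ℝ) - q • EuclideanSpace.projₗ j) (fun h0 => by
      have := LinearMap.congr_fun h0 (EuclideanSpace.single i 1)
      simp [hij.symm] at this)
  simpa [sub_eq_zero] using this

/-- The excluded sets are null and `U` is not. The condition `‖y‖ ≠ 1` gives a preimage of nonzero
height. -/
theorem exists_generic_mem {U : Set E3} (hU : IsOpen U) (hne : U.Nonempty) :
    ∃ y ∈ U, y 0 ≠ 0 ∧ y 2 ≠ 0 ∧ ‖y‖ ≠ 1 := by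
  have h0 : ∀ᵐ y : E3, y 0 ≠ 0 := by
    simpa [ae_iff] using volume_setOf_coord_eq_mul_coord (i := 0) (j := 1) (by decide) 0
  have h2 : ∀ᵐ y : E3, y 2 ≠ 0 := by
    simpa [ae_iff] using volume_setOf_coord_eq_mul_coord (i := 2) (j := 1) (by decide) 0
  have h3 : ∀ᵐ y : E3, ‖y‖ ≠ 1 := by
    have := Measure.addHaar_sphere (volume : Measure E3) 0 1
    simpa [ae_iff, sphere] using this
  have hfr : ∃ᵐ y : E3, y ∈ U := by
    rw [frequently_ae_mem_iff]
    exact (hU.measure_pos volume hne).ne'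
  obtain ⟨y, hyU, hy⟩ := (hfr.and_eventually (h0.and (h2.and h3))).exists
  exact ⟨y, hyU, hy⟩

theorem exists_ball_subset_zorich_zorich_preimage {U : Set E3} (hU : IsOpen U)
    (hne : U.Nonempty) :
    ∃ C > 0, ∃ c > 0, ∃ δ > 0, ∃ S : ℝ, ∀ x : E3, ∀ m n : ℤ,
      x 0 = Real.pi / 2 + m * (2 * Real.pi) → |x 1 - n * (2 * Real.pi)| < δ → S < x 2 →
      ∃ x' ∈ closedBall x (C * Real.exp (-x 2)),
        ball x' (c * Real.exp (-x 2)) ⊆ interior ((zorich ∘ zorich) ⁻¹' U) := by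
  obtain ⟨y, hyU, hy0, hy2, hy⟩ := exists_generic_mem hU hne
  obtain ⟨T, hT2, hT, hTc⟩ := exists_zorich_eq hy0 hy2 hy
  obtain ⟨ε, hε, hball⟩ := Metric.mem_nhds_iff.1 (hTc (hU.mem_nhds (by rwa [hT])))
  obtain ⟨C, hC, c, hc, δ, hδ, S, H⟩ := exists_ball_zorich_near_lattice_of_ne_zero hε hT2
  refine ⟨C, hC, c, hc, δ, hδ, S, fun x m n hx0 hx1 hx2 => ?_⟩
  have hxl : (x - latticeVec m n) 2 = x 2 := by simp [latticeVec]
  obtain ⟨x', hx', hz⟩ := H (x - latticeVec m n) (by simp [latticeVec, hx0])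
    (by simpa [latticeVec]) (by rwa [hxl])
  rw [hxl] at hx' hz
  refine ⟨x' + latticeVec m n, ?_, interior_maximal (fun z hz' => ?_) isOpen_ball⟩
  · rw [mem_closedBall] at hx' ⊢
    rwa [← dist_add_right _ _ (latticeVec m n), sub_add_cancel] at hx'
  · obtain ⟨k, l, hkl⟩ := hz (z - latticeVec m n) (by
      rw [mem_ball] at hz' ⊢
      rwa [← dist_add_right _ _ (latticeVec m n), sub_add_cancel])
    have h1 : zorich (z - latticeVec m n) = zorich z := by
      rw [← zorich_add_latticeVec _ m n, sub_add_cancel]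
    rw [h1] at hkl
    have h2 : zorich z - latticeVec k l ∈ ball T ε := by
      rw [mem_ball] at hkl ⊢
      rwa [← dist_add_right _ _ (latticeVec k l), sub_add_cancel]
    have h3 := hball h2
    rw [mem_preimage, ← zorich_add_latticeVec _ k l, sub_add_cancel] at h3
    exact h3

/-! ### Porous sets and lines -/

/-- A set that is porous at almost all points is a null set. -/
theorem measure_eq_zero_of_porous {E : Type*} [NormedAddCommGroup E] [NormedSpace ℝ E]
    [FiniteDimensional ℝ E] [MeasurableSpace E] [BorelSpace E] (μ : Measure E)
    [μ.IsAddHaarMeasure] {s : Set E}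
    (hs : ∀ᵐ x ∂μ, ∃ C > 0, ∃ c > 0, ∃ᶠ r : ℝ in 𝓝[>] 0,
      ∃ y ∈ closedBall x (C * r), Disjoint (ball y (c * r)) s) : μ s = 0 := by
  suffices h : ∀ᵐ x ∂μ.restrict s, False by
    simpa [ae_iff] using h
  filter_upwards [Besicovitch.ae_tendsto_measure_inter_div μ s, ae_restrict_of_ae hs]
    with x hx ⟨C, hC, c, hc, hr⟩
  -- The proportion of the ball of radius `(C + c) * r` about `x` filled by the hole, which
  -- contradicts density one.
  set κ : ℝ := (c / (C + c)) ^ Module.finrank ℝ E with hκ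
  have hκ0 : 0 < κ := by positivity
  have hlim : Tendsto (fun r : ℝ => (C + c) * r) (𝓝[>] (0 : ℝ)) (𝓝[>] 0) := by
    refine tendsto_nhdsWithin_iff.2 ⟨?_, ?_⟩
    · exact (Continuous.tendsto' (by fun_prop) _ _ (by simp)).mono_left nhdsWithin_le_nhds
    · filter_upwards [self_mem_nhdsWithin] with r hr
      exact mul_pos (add_pos hC hc) hr
  have hlt : 1 - ENNReal.ofReal κ < 1 :=
    ENNReal.sub_lt_self ENNReal.one_ne_top one_ne_zero (ENNReal.ofReal_pos.2 hκ0).ne'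
  obtain ⟨r, ⟨y, hy, hd⟩, hgt, hr0⟩ := (hr.and_eventually
    (((hx.comp hlim).eventually (lt_mem_nhds hlt)).and self_mem_nhdsWithin)).exists
  replace hr0 : 0 < r := hr0
  set B := closedBall x ((C + c) * r) with hB
  have hsub : ball y (c * r) ⊆ B := fun z hz => by
    rw [mem_ball] at hz
    rw [mem_closedBall] at hy ⊢
    linarith [dist_triangle z y x]
  have hB0 : μ B ≠ 0 := (measure_closedBall_pos μ x (by positivity)).ne'
  have hBtop : μ B ≠ ⊤ := measure_closedBall_lt_top.ne
  have hball : μ (ball y (c * r)) = ENNReal.ofReal κ * μ B := by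
    rw [hB, Measure.addHaar_ball_of_pos μ y (by positivity),
      Measure.addHaar_closedBall μ x (by positivity), ← mul_assoc,
      ← ENNReal.ofReal_mul hκ0.le, hκ, ← mul_pow]
    congr 3
    field_simp
  have hle : μ (s ∩ B) ≤ (1 - ENNReal.ofReal κ) * μ B := by
    calc μ (s ∩ B) ≤ μ (B \ ball y (c * r)) :=
          measure_mono fun z hz => ⟨hz.2, fun hz' => hd.le_bot ⟨hz', hz.1⟩⟩
      _ = (1 - ENNReal.ofReal κ) * μ B := by
          rw [measure_sdiff hsub measurableSet_ball.nullMeasurableSet measure_ball_lt_top.ne,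
            hball, ENNReal.sub_mul (fun _ _ => hBtop), one_mul]
  exact absurd (ENNReal.div_le_of_le_mul hle) (not_le.2 hgt)

/-- Irrational rotations return to every arc infinitely often. -/
theorem frequently_abs_add_mul_sub_lt {p θ : ℝ} (hp : 0 < p) (hθ : Irrational (θ / p)) (a : ℝ)
    {δ : ℝ} (hδ : 0 < δ) : ∃ᶠ k : ℕ in atTop, ∃ n : ℤ, |a + k * θ - n * p| < δ := by
  have : Fact (0 < p) := ⟨hp⟩
  have hd : DenseRange (· • (θ : AddCircle p) : ℤ → AddCircle p) :=
    AddCircle.denseRange_zsmul_coe_iff.2 hθ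
  have hc : MapClusterPt ((-a : ℝ) : AddCircle p) atTop (fun k : ℕ => k • (θ : AddCircle p)) :=
    ((mapClusterPt_atTop_nsmul_tfae _ _).out 3 0).1 (hd _)
  refine (hc.frequently (ball_mem_nhds _ hδ)).mono fun k hk => ?_
  rw [dist_eq_norm, ← AddCircle.coe_nsmul, ← AddCircle.coe_sub, AddCircle.norm_eq] at hk
  refine ⟨round (p⁻¹ * (k • θ - -a)), ?_⟩
  convert! hk using 2
  simp
  ring

/-- The directions of the lines through `P` that miss `W`. -/
def missing (P : E3) (W : Set E3) : Set E3 := {v | ∀ t : ℝ, P + t • v ∉ W}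

theorem missing_porous {U : Set E3} (hU : IsOpen U) (hne : U.Nonempty) (P : E3) {v : E3}
    (h0 : v 0 ≠ 0) (h2 : v 2 ≠ 0) (hirr : Irrational (v 1 / v 0)) :
    ∃ C > 0, ∃ c > 0, ∃ᶠ r : ℝ in 𝓝[>] 0, ∃ y ∈ closedBall v (C * r),
      Disjoint (ball y (c * r)) (missing P (interior ((zorich ∘ zorich) ⁻¹' U))) := by
  obtain ⟨C, hC, c, hc, δ, hδ, S, H⟩ := exists_ball_subset_zorich_zorich_preimage hU hne
  refine ⟨C, hC, c, hc, ?_⟩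
  have hpi := Real.pi_pos
  -- The sign `σ` selects the direction of travel in which the height tends to `+∞`.
  obtain ⟨σ, hσ0, hσ⟩ : ∃ σ : ℤ, σ ≠ 0 ∧ 0 < σ * (v 2 / v 0) := by
    rcases (div_ne_zero h2 h0).lt_or_gt with h | h
    · exact ⟨-1, by norm_num, by push_cast; linarith⟩
    · exact ⟨1, by norm_num, by push_cast; linarith⟩
  -- The time at which the line meets the plane `x 0 = π/2 + 2πσk`.
  set τ : ℕ → ℝ := fun k => (Real.pi / 2 - P 0 + (σ * k : ℤ) * (2 * Real.pi)) / v 0 with hτ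
  have hx2 : Tendsto (fun k => τ k * v 2) atTop atTop := by
    have : (fun k => τ k * v 2) = fun k : ℕ =>
        (Real.pi / 2 - P 0) / v 0 * v 2 + σ * (v 2 / v 0) * (2 * Real.pi) * k := by
      funext k
      simp only [hτ]
      push_cast
      field_simp
    rw [this]
    exact tendsto_atTop_add_const_left _ _
      (tendsto_natCast_atTop_atTop.const_mul_atTop (by positivity))
  have hx2' : Tendsto (fun k => P 2 + τ k * v 2) atTop atTop :=
    tendsto_atTop_add_const_left _ _ hx2
  have habs : Tendsto (fun k => |τ k|) atTop atTop := by
    have := (tendsto_abs_atTop_atTop.comp hx2).atTop_div_const (abs_pos.2 h2)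
    refine this.congr fun k => ?_
    simp only [Function.comp, abs_mul]
    field_simp
  have hr : Tendsto (fun k => Real.exp (-(P 2 + τ k * v 2)) * |τ k|⁻¹) atTop (𝓝[>] 0) := by
    refine tendsto_nhdsWithin_iff.2 ⟨?_, ?_⟩
    · simpa using (Real.tendsto_exp_neg_atTop_nhds_zero.comp hx2').mul habs.inv_tendsto_atTop
    · filter_upwards [habs.eventually_gt_atTop 0] with k hk
      exact mul_pos (Real.exp_pos _) (inv_pos.2 hk)
  -- At these times `x 1` modulo `2π` follows a rotation with irrational ratio `σ * (v 1 / v 0)`.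
  have hrec := frequently_abs_add_mul_sub_lt (p := 2 * Real.pi)
    (θ := σ * (v 1 / v 0) * (2 * Real.pi)) (by positivity)
    (by
      rw [mul_div_cancel_right₀ _ (by positivity)]
      exact hirr.intCast_mul hσ0)
    (P 1 + (Real.pi / 2 - P 0) / v 0 * v 1) hδ
  refine hr.frequently ((hrec.and_eventually ((hx2'.eventually_gt_atTop S).and
    (habs.eventually_gt_atTop 0))).mono ?_)
  rintro k ⟨⟨n, hn⟩, hS, hτ0⟩
  have hτne : τ k ≠ 0 := abs_pos.1 hτ0
  obtain ⟨x', hx', hball⟩ := H (P + τ k • v) (σ * k) n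
    (by simp [hτ]; field_simp; ring)
    (by
      convert! hn using 2
      simp [hτ]
      field_simp
      ring)
    (by simpa using hS)
  simp only [PiLp.add_apply, PiLp.smul_apply, smul_eq_mul] at hx' hball
  set e := Real.exp (-(P 2 + τ k * v 2))
  refine ⟨(τ k)⁻¹ • (x' - P), ?_, ?_⟩
  · rw [mem_closedBall, dist_eq_norm] at hx' ⊢
    rw [show (τ k)⁻¹ • (x' - P) - v = (τ k)⁻¹ • (x' - (P + τ k • v)) by
      rw [← sub_sub, smul_sub _ (x' - P), inv_smul_smul₀ hτne], norm_smul, norm_inv,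
      Real.norm_eq_abs]
    calc |τ k|⁻¹ * ‖x' - (P + τ k • v)‖ ≤ |τ k|⁻¹ * (C * e) := by gcongr
      _ = C * (e * |τ k|⁻¹) := by ring
  · rw [Set.disjoint_left]
    intro w hw hmiss
    refine hmiss (τ k) (hball ?_)
    rw [mem_ball, dist_eq_norm] at hw ⊢
    rw [show P + τ k • w - x' = τ k • (w - (τ k)⁻¹ • (x' - P)) by
      rw [smul_sub, smul_inv_smul₀ hτne]; abel, norm_smul, Real.norm_eq_abs]
    calc |τ k| * ‖w - (τ k)⁻¹ • (x' - P)‖ < |τ k| * (c * (e * |τ k|⁻¹)) := by gcongr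
      _ = c * e := by field_simp

theorem volume_missing {U : Set E3} (hU : IsOpen U) (hne : U.Nonempty) (P : E3) :
    volume (missing P (interior ((zorich ∘ zorich) ⁻¹' U))) = 0 := by
  have h0 : ∀ᵐ v : E3, v 0 ≠ 0 := by
    simpa [ae_iff] using volume_setOf_coord_eq_mul_coord (i := 0) (j := 1) (by decide) 0
  have h2 : ∀ᵐ v : E3, v 2 ≠ 0 := by
    simpa [ae_iff] using volume_setOf_coord_eq_mul_coord (i := 2) (j := 1) (by decide) 0
  have h1 : ∀ᵐ v : E3, ∀ q : ℚ, v 1 ≠ q * v 0 := ae_all_iff.2 fun q => by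
    simpa [ae_iff] using volume_setOf_coord_eq_mul_coord (i := 1) (j := 0) (by decide) q
  refine measure_eq_zero_of_porous volume ?_
  filter_upwards [h0, h1, h2] with v h0 h1 h2
  refine missing_porous hU hne P h0 h2 ?_
  rintro ⟨q, hq⟩
  exact h1 q (by rw [hq]; field_simp)

/-! ### From vectors to unit directions and to lines -/

theorem ae_surfaceMeasure_exists_mem {U : Set E3} (hU : IsOpen U) (hne : U.Nonempty) (P : E3) :
    ∀ᵐ (u : S2) ∂surfaceMeasure, ∃ t : ℝ, P + t • (u : E3) ∈ interior ((zorich ∘ zorich) ⁻¹' U) := by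
  set W := interior ((zorich ∘ zorich) ⁻¹' U)
  have hopen : IsOpen {u : S2 | ∃ t : ℝ, P + t • (u : E3) ∈ W} := by
    simp only [ofPred_exists]
    exact isOpen_iUnion fun t => isOpen_interior.preimage (by fun_prop)
  rw [ae_iff, surfaceMeasure]
  change Measure.toSphere (volume : Measure E3) {u : S2 | ∃ t : ℝ, P + t • (u : E3) ∈ W}ᶜ = 0
  -- Surface measure is a multiple of the volume of the cone, and missing `W` is invariant under
  -- positive scaling.
  rw [Measure.toSphere_apply' _ hopen.measurableSet.compl]
  refine mul_eq_zero_of_right _ (measure_mono_null ?_ (volume_missing hU hne P))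
  rintro _ ⟨r, -, _, ⟨u, hu, rfl⟩, rfl⟩ t ht
  exact hu ⟨t * r, by simpa [smul_smul] using ht⟩

/-- The line `P + ℝ u` meets the interior of the preimage under `𝒵 ∘ 𝒵` of every nonempty basic
open set. -/
def MeetsBasis (P : E3) (u : S2) : Prop :=
  ∀ B ∈ TopologicalSpace.countableBasis E3,
    ∃ t : ℝ, P + t • (u : E3) ∈ interior ((zorich ∘ zorich) ⁻¹' B)

theorem ae_meetsBasis (P : E3) : ∀ᵐ u ∂surfaceMeasure, MeetsBasis P u := by
  refine (ae_ball_iff (TopologicalSpace.countable_countableBasis E3)).2 fun B hB => ?_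
  exact ae_surfaceMeasure_exists_mem (TopologicalSpace.isOpen_of_mem_countableBasis hB)
    (TopologicalSpace.nonempty_of_mem_countableBasis hB) P

/-- Taking interiors makes each condition open, so no global continuity of `zorich` is needed. -/
theorem measurableSet_meetsBasis : MeasurableSet {q : S2 × E3 | MeetsBasis q.2 q.1} := by
  simp only [MeetsBasis, ofPred_forall, ofPred_exists]
  refine MeasurableSet.biInter (TopologicalSpace.countable_countableBasis E3) fun B _ => ?_
  exact (isOpen_iUnion fun t => isOpen_interior.preimage (by fun_prop)).measurableSet

theorem mem_lineThrough {P : E3} {u : S2} {x : E3} :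
    x ∈ (lineThrough P u).1 ↔ ∃ t : ℝ, P + t • (u : E3) = x := by
  rw [lineThrough, AffineSubspace.mem_mk', Submodule.mem_span_singleton]
  simp [eq_sub_iff_add_eq']

/-- The lines that meet the interior of the preimage under `𝒵 ∘ 𝒵` of every nonempty basic
open set. -/
def basisMeetingLines : Set Line :=
  {L | ∀ B ∈ TopologicalSpace.countableBasis E3,
    ∃ x ∈ L.1, x ∈ interior ((zorich ∘ zorich) ⁻¹' B)}

theorem lineThrough_mem_basisMeetingLines {P : E3} {u : S2} :
    lineThrough P u ∈ basisMeetingLines ↔ MeetsBasis P u := by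
  simp [basisMeetingLines, MeetsBasis, mem_lineThrough]

theorem dense_image_of_mem_basisMeetingLines {L : Line} (hL : L ∈ basisMeetingLines) :
    Dense ((zorich ∘ zorich) '' (L.1 : Set E3)) := by
  rw [(TopologicalSpace.isBasis_countableBasis E3).dense_iff]
  intro B hB _
  obtain ⟨x, hxL, hx⟩ := hL B hB
  exact ⟨_, (interior_subset hx : x ∈ (zorich ∘ zorich) ⁻¹' B), x, hxL, rfl⟩

theorem ae_mem_basisMeetingLines : ∀ᵐ L ∂lineMeasure, L ∈ basisMeetingLines := by
  have hpre : lineMap ⁻¹' basisMeetingLines = {q | MeetsBasis q.2 q.1} := by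
    ext q
    exact lineThrough_mem_basisMeetingLines
  have hmeas : MeasurableSet basisMeetingLines := by
    change MeasurableSet (lineMap ⁻¹' basisMeetingLines)
    rw [hpre]
    exact measurableSet_meetsBasis
  have : IsFiniteMeasure surfaceMeasure := by
    rw [surfaceMeasure]
    infer_instance
  rw [lineMeasure]
  refine (mem_ae_map_iff measurable_lineMap.aemeasurable hmeas).2 ?_
  rw [hpre]
  refine ae_restrict_of_ae (p := fun q : S2 × E3 => MeetsBasis q.2 q.1) ?_
  refine (Measure.ae_prod_mem_iff_ae_ae_mem measurableSet_meetsBasis).2 ?_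
  -- The result for each fixed `P` and almost every `u` is exchanged, by Fubini, into one for almost
  -- every `u` and almost every `P`.
  exact (Measure.ae_ae_comm (p := fun (u : S2) (P : E3) => MeetsBasis P u)
    measurableSet_meetsBasis).2 (ae_of_all _ ae_meetsBasis)

end Zorich

end

theorem theorem1 :
    (∀ᵐ L ∂Zorich.lineMeasure,
      Dense ((Zorich.zorich ∘ Zorich.zorich) '' (L.1 : Set Zorich.E3))) ∧
    (∀ P : Zorich.E3, ∀ᵐ u ∂Zorich.surfaceMeasure,
      Dense ((Zorich.zorich ∘ Zorich.zorich) ''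
        ((Zorich.lineThrough P u).1 : Set Zorich.E3))) := by
  refine ⟨?_, fun P => ?_⟩
  · filter_upwards [Zorich.ae_mem_basisMeetingLines] with L hL
    exact Zorich.dense_image_of_mem_basisMeetingLines hL
  · filter_upwards [Zorich.ae_meetsBasis P] with u hu
    exact Zorich.dense_image_of_mem_basisMeetingLines
      (Zorich.lineThrough_mem_basisMeetingLines.2 hu)
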